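/- Let $1\le k\le n$ and $M\ge 0$ be integers and $m=M/n$. For $S\subseteq[n]=\{1,\dots,n\}$ and $0<\rho<1$ let $\mathbb P_S=N(0,\Sigma_S)$ on $\mathbb R^n$, where $(\Sigma_S)_{ii}=1$, $(\Sigma_S)_{ij}=\rho$ for distinct $i,j\in S$, and $(\Sigma_S)_{ij}=0$ otherwise. Let $\mathcal C$ be one of the following classes of subsets of $[n]$: all $k$-sets; all $k$-intervals $\{z,\dots,z+k-1\}$, $1\le z\le n-k+1$; the disjoint $k$-intervals $\{(j-1)k+1,\dots,jk\}$, $1\le j\le\lfloor n/k\rfloor$. An adaptive sensing strategy $\mathcal A$ with budget $M$ chooses, in each of $M$ rounds $t=1,\dots,M$, a (possibly empty) query set $A^t\subseteq[n]$ according to a conditional distribution given the history $(A^j,X^j)_{j<t}$, subject to $\sum_{t=1}^M|A^t|\le M$. It then observes $X^t\in\mathbb R^n$, which agrees with $U^t$ on the coordinates in $A^t$ and is $0$ on the others, where $U^1,U^2,\dots$ are i.i.d. with law $\mathbb P_S$, each $U^t$ being independent of the history and of $A^t$. Let $\mathbb P_S^{\mathcal A}$ be the law of $(A^1,X^1,\dots,A^M,X^M)$;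 a test $\phi$ is a measurable $\{0,1\}$-valued function of this sequence. Define the minimax risk $$R^*_{\mathbf{AS}}=\inf_{\mathcal A,\phi}\Big[\mathbb P_\emptyset^{\mathcal A}(\phi\ne0)+\max_{S\in\mathcal C}\mathbb P_S^{\mathcal A}(\phi\ne1)\Big]$$ and $$D(\rho,k)=\min\Big[\frac{\rho}{2(1-\rho)},\ \rho^2(k+1)\Big].$$ (i) If $0<\rho\le 1/2$, then for each of the three classes $$R^*_{\mathbf{AS}}\ \ge\ \tfrac14\exp\big(-m\,k\,D(\rho,k)\big).$$ (ii) Consequently, for any sequence of parameters $(n,k,M,\rho)$ as above, with $\rho\in(0,1/2]$ throughout, if $R^*_{\mathbf{AS}}\to0$ then $m\,k\,D(\rho,k)\to\infty$. The same conclusion holds for sequences with $\rho\in(0,1)$ provided that $mk\to\infty$ (in particular whenever $m,k\to\infty$). -/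

import Mathlib

open MeasureTheory ProbabilityTheory Filter Topology
open scoped ENNReal

noncomputable section

namespace CorrDetect

/-- The three kinds of classes of contaminated sets. -/
inductive ClassKind where
  | kSets
  | kIntervals
  | disjointKIntervals

/-- The class of contaminated sets of size `k` in `{0, …, n-1}` (coordinates are numbered from
`0`): all `k`-subsets; all sets of `k` contiguous coordinates `{z, …, z+k-1}`; or the consecutive
blocks `{jk, …, (j+1)k-1}` for `j < ⌊n/k⌋`. -/
def ClassKind.sets (c : ClassKind) (n k : ℕ) : Set (Finset (Fin n)) :=
  match c with
  | .kSets => {S | S.card = k}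
  | .kIntervals =>
      {S | ∃ z : ℕ, z + k ≤ n ∧ S = Finset.univ.filter (fun i : Fin n => z ≤ i ∧ (i : ℕ) < z + k)}
  | .disjointKIntervals =>
      {S | ∃ j : ℕ, j < n / k ∧
        S = Finset.univ.filter (fun i : Fin n => j * k ≤ i ∧ (i : ℕ) < (j + 1) * k)}

/-- The covariance matrix `Σ_S`: unit diagonal, `ρ` between distinct elements of `S`, and `0`
elsewhere. -/
def covMatrix {n : ℕ} (ρ : ℝ) (S : Finset (Fin n)) : Matrix (Fin n) (Fin n) ℝ :=
  Matrix.of fun i j => if i = j then 1 else if i ∈ S ∧ j ∈ S then ρ else 0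

/-- The law `P_S` of one full vector `U ~ N(0, Σ_S)`. -/
def vectorLaw {n : ℕ} (ρ : ℝ) (S : Finset (Fin n)) : Measure (EuclideanSpace ℝ (Fin n)) :=
  multivariateGaussian 0 (covMatrix ρ S)

/-- Keep the coordinates in the query set `a` and replace all others by `0`. -/
def mask {n : ℕ} (a : Finset (Fin n)) (u : EuclideanSpace ℝ (Fin n)) :
    EuclideanSpace ℝ (Fin n) :=
  WithLp.toLp 2 fun i => if i ∈ a then u i else 0

/-- The conditional law of the observation given the query set: the masked version of a fresh
vector drawn from `P_S`. -/
def obsKernel {n : ℕ} (ρ : ℝ) (S : Finset (Fin n)) :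
    Kernel (Finset (Fin n)) (EuclideanSpace ℝ (Fin n)) :=
  Kernel.ofFunOfCountable fun a => (vectorLaw ρ S).map (mask a)

/-- Histories after `t` rounds: the sequence of queries and observations. -/
abbrev History (n t : ℕ) : Type :=
  Fin t → Finset (Fin n) × EuclideanSpace ℝ (Fin n)

/-- The number of coordinate measurements used in a history. -/
def spent {n t : ℕ} (h : History n t) : ℕ := ∑ j, (h j).1.card

/-- Adaptive sensing strategies with budget `M`: for each round, the conditional distribution of
the next (possibly empty) query set given the history, such that the total number of measured
coordinates over the `M` rounds never exceeds `M`. Only the kernels of the rounds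
`t = 0, …, M - 1` are ever used. -/
structure SensingStrategy (n M : ℕ) where
  query : (t : ℕ) → Kernel (History n t) (Finset (Fin n))
  isMarkov : ∀ t, IsMarkovKernel (query t)
  budget : ∀ t < M, ∀ h : History n t, spent h ≤ M →
    ∀ᵐ a ∂(query t h), spent h + a.card ≤ M

/-- The joint law of the first `t` queries and observations when the contaminated set is `S`:
given the history, draw the query from the strategy, then the observation given the query, and
append the pair to the history. -/
def SensingStrategy.law {n M : ℕ} (A : SensingStrategy n M) (ρ : ℝ) (S : Finset (Fin n)) :
    (t : ℕ) → Measure (History n t)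
  | 0 => Measure.dirac Fin.elim0
  | t + 1 =>
      (A.law ρ S t ⊗ₘ (A.query t ⊗ₖ (obsKernel ρ S).prodMkLeft (History n t))).map
        fun p => (Fin.snoc p.1 p.2 : History n (t + 1))

/-- Worst-case risk of the procedure `(A, φ)`: the probability of rejecting under the null plus
the largest probability of not rejecting over `S ∈ C`. -/
def risk {n M : ℕ} (ρ : ℝ) (C : Set (Finset (Fin n))) (A : SensingStrategy n M)
    (φ : History n M → Bool) : ℝ≥0∞ :=
  A.law ρ ∅ M {z | φ z ≠ false} + ⨆ S ∈ C, A.law ρ S M {z | φ z ≠ true}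

/-- Minimax risk over all adaptive testing procedures with a budget of `M` measurements. -/
def minimaxRisk {n : ℕ} (M : ℕ) (ρ : ℝ) (C : Set (Finset (Fin n))) : ℝ≥0∞ :=
  ⨅ (A : SensingStrategy n M) (φ : History n M → Bool) (_ : Measurable φ), risk ρ C A φ

/-- `D(ρ, k) = min [ρ / (2 (1 - ρ)), ρ² (k + 1)]`. -/
def divBound (ρ : ℝ) (k : ℕ) : ℝ := min (ρ / (2 * (1 - ρ))) (ρ ^ 2 * (k + 1))

end CorrDetect

end

/-! Every class contains the `N = ⌊n/k⌋` disjoint blocks of length `k`, and the budget cannot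
examine all of them well. For a single `S`, Cauchy–Schwarz bounds twice the risk below by the
squared Hellinger affinity `(E₀ exp (L_S / 2))²`, where `L_S` is the log-likelihood ratio of the
whole history and `E₀` is expectation under the null (`sq_lintegral_exp_half_le`). The query kernels
do not depend on `S`, so they cancel and `L_S` is a sum over rounds (`law_eq_withDensity`).

By convexity of `exp`, the mean of the `N` block affinities is at least `E₀ exp ((2N)⁻¹ ∑ L_B)`.
Given a query `a`, Jensen bounds the factor of that round below by the exponential of `-(2N)⁻¹ ∑
gaussDiv |a ∩ B|`. The divergence costs at most `D/2` per coordinate (`gaussDiv_le`) and the blocks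
are disjoint, so the factor is at least `exp (-D |a| / (4N))`. Compensated by `exp (D |a| / (4N))`,
the product over rounds is a submartingale, however the queries adapt. Since the queries total at
most `M`, twice the risk is at least `exp (-D M / (2N))`, and `n ≤ 2 N k` turns the exponent into
`-m k D`.

The limits follow by taking logarithms; when `ρ > 1/2` one has `D ≥ 1/2`, so `m k → ∞` suffices. -/

namespace CorrDetect

/-! ### Densities of Gaussian measures. -/

section GaussianDensity

open Matrix WithLp Module
open scoped RealInnerProductSpace MatrixOrder

/-- The density of the standard Gaussian measure with respect to Lebesgue measure. -/
lemma stdGaussian_eq_withDensity (E : Type*) [NormedAddCommGroup E] [InnerProductSpace ℝ E]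
    [FiniteDimensional ℝ E] [MeasurableSpace E] [BorelSpace E] :
    stdGaussian E = volume.withDensity fun x : E =>
      ENNReal.ofReal (((2 * Real.pi) ^ (finrank ℝ E / 2 : ℝ))⁻¹ * Real.exp (-‖x‖ ^ 2 / 2)) := by
  set c : ℝ := (2 * Real.pi) ^ (finrank ℝ E / 2 : ℝ) with hc
  have hc0 : 0 < c := by positivity
  have hint : Integrable (fun x : E => c⁻¹ * Real.exp (-‖x‖ ^ 2 / 2)) := by
    have h := (GaussianFourier.integrable_cexp_neg_mul_sq_norm_add (V := E) (b := (1 / 2 : ℂ))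
      (by norm_num) 0 0).re
    refine (h.const_mul c⁻¹).congr (ae_of_all _ fun x => ?_)
    have : (-(1 / 2 : ℂ) * (‖x‖ : ℂ) ^ 2 + 0 * ((⟪(0 : E), x⟫ : ℝ) : ℂ)) =
        ((-‖x‖ ^ 2 / 2 : ℝ) : ℂ) := by push_cast; ring
    simp only [this, ← Complex.ofReal_exp]
    exact congrArg (c⁻¹ * ·) (Complex.ofReal_re _)
  have hfin : IsFiniteMeasure (volume.withDensity fun x : E =>
      ENNReal.ofReal (c⁻¹ * Real.exp (-‖x‖ ^ 2 / 2))) :=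
    isFiniteMeasure_withDensity_ofReal hint.2
  -- Finite measures are determined by their characteristic functions; the one on the density side
  -- is the Gaussian Fourier integral with parameter `1/2`.
  refine Measure.ext_of_charFun ?_
  ext t
  rw [charFun_stdGaussian, charFun_apply, integral_withDensity_eq_integral_toReal_smul
    (by fun_prop) (ae_of_all _ fun _ => ENNReal.ofReal_lt_top)]
  have h := GaussianFourier.integral_cexp_neg_mul_sq_norm_add (V := E) (b := (1 / 2 : ℂ))
      (by norm_num) Complex.I t
  have e : ∀ x : E, (ENNReal.ofReal (c⁻¹ * Real.exp (-‖x‖ ^ 2 / 2))).toReal •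
      Complex.exp ((⟪x, t⟫ : ℝ) * Complex.I) =
      (c⁻¹ : ℂ) * Complex.exp (-(1 / 2 : ℂ) * (‖x‖ : ℂ) ^ 2 + Complex.I * (⟪t, x⟫ : ℝ)) := by
    intro x
    rw [ENNReal.toReal_ofReal (by positivity), Complex.exp_add, Complex.real_smul,
      real_inner_comm]
    push_cast
    rw [mul_assoc]
    congr 3
    · ring
    · ring
  simp_rw [e]
  rw [integral_const_mul, h]
  have hpi : ((Real.pi : ℂ) / (1 / 2)) ^ ((finrank ℝ E : ℂ) / 2) = (c : ℂ) := by
    rw [hc, Complex.ofReal_cpow (by positivity)]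
    push_cast
    congr 1
    ring
  rw [hpi, ← mul_assoc, inv_mul_cancel₀ (by exact_mod_cast hc0.ne'), one_mul]
  congr 1
  simp only [Complex.I_sq]
  ring

lemma det_toEuclideanCLM {ι : Type*} [Fintype ι] [DecidableEq ι] (R : Matrix ι ι ℝ) :
    LinearMap.det (toEuclideanCLM (𝕜 := ℝ) R : EuclideanSpace ℝ ι →ₗ[ℝ] EuclideanSpace ℝ ι) =
      R.det := by
  have : (toEuclideanCLM (𝕜 := ℝ) R : EuclideanSpace ℝ ι →ₗ[ℝ] EuclideanSpace ℝ ι) =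
      toLin (EuclideanSpace.basisFun ι ℝ).toBasis (EuclideanSpace.basisFun ι ℝ).toBasis R := by
    rw [coe_toEuclideanCLM_eq_toEuclideanLin, toEuclideanLin_eq_toLin_orthonormal]
  rw [this, LinearMap.det_toLin]

/-- The density of a centered nondegenerate Gaussian measure with respect to the standard one. -/
lemma multivariateGaussian_zero_eq_withDensity {ι : Type*} [Fintype ι] [DecidableEq ι]
    {S : Matrix ι ι ℝ} (hS : S.PosDef) :
    multivariateGaussian 0 S = (stdGaussian (EuclideanSpace ℝ ι)).withDensity fun y =>
      ENNReal.ofReal (Real.exp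
        (-(Real.log S.det + (y.ofLp ⬝ᵥ S⁻¹ *ᵥ y.ofLp - y.ofLp ⬝ᵥ y.ofLp)) / 2)) := by
  set R := CFC.sqrt S with hR
  have hRR : R * R = S := CFC.sqrt_mul_sqrt_self _ hS.posSemidef.nonneg
  have hRs : Rᵀ = R := by
    have := (CFC.sqrt_nonneg S).isSelfAdjoint
    simpa [IsSelfAdjoint, star_eq_conjTranspose] using this
  have hdet : R.det * R.det = S.det := by rw [← det_mul, hRR]
  have hSdet := hS.det_pos
  have hR0 : R.det ≠ 0 := by
    intro h; rw [h] at hdet; simp at hdet; linarith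
  have hRu : IsUnit R.det := hR0.isUnit
  set T := toEuclideanCLM (𝕜 := ℝ) R with hT
  set g : EuclideanSpace ℝ ι → ℝ := fun x =>
    ((2 * Real.pi) ^ (finrank ℝ (EuclideanSpace ℝ ι) / 2 : ℝ))⁻¹ * Real.exp (-‖x‖ ^ 2 / 2) with hg
  have hgm : Measurable fun x => ENNReal.ofReal (g x) := by fun_prop
  set T' := toEuclideanCLM (𝕜 := ℝ) R⁻¹ with hT'
  have hinv : ∀ x, T' (T x) = x := by
    intro x
    rw [← mul_apply_eq_comp, hT, hT', ← map_mul, nonsing_inv_mul _ hRu]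
    simp
  have hmap : Measure.map T volume = ENNReal.ofReal |R.det⁻¹| • volume := by
    have := Measure.map_linearMap_addHaar_eq_smul_addHaar
      (volume : Measure (EuclideanSpace ℝ ι))
      (f := (T : EuclideanSpace ℝ ι →ₗ[ℝ] EuclideanSpace ℝ ι))
      (by rwa [hT, det_toEuclideanCLM])
    rwa [hT, det_toEuclideanCLM] at this
  -- Change of variables along `R = √S`: the Jacobian yields the `log det` term, and `‖R⁻¹ y‖²` is
  -- the quadratic form of `S⁻¹`.
  have key : ∀ y, |R.det⁻¹| * g (T' y) = g y * Real.exp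
        (-(Real.log S.det + (y.ofLp ⬝ᵥ S⁻¹ *ᵥ y.ofLp - y.ofLp ⬝ᵥ y.ofLp)) / 2) := by
    intro y
    have h1 : ‖T' y‖ ^ 2 = y.ofLp ⬝ᵥ S⁻¹ *ᵥ y.ofLp := by
      have hy : T' y = toLp 2 (R⁻¹ *ᵥ y.ofLp) := by
        rw [hT', ← toEuclideanCLM_toLp]
      have hs : R⁻¹ᵀ = R⁻¹ := by rw [transpose_nonsing_inv, hRs]
      rw [hy, EuclideanSpace.real_norm_sq_eq, ← hRR, Matrix.mul_inv_rev, ← mulVec_mulVec,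
        dotProduct_mulVec, ← mulVec_transpose, hs]
      simp [dotProduct, sq]
    have h2 : ‖y‖ ^ 2 = y.ofLp ⬝ᵥ y.ofLp := by
      rw [EuclideanSpace.real_norm_sq_eq]; simp [dotProduct, sq]
    have h3 : |R.det⁻¹| = Real.exp (-Real.log S.det / 2) := by
      rw [← hdet, ← abs_mul_abs_self, Real.log_mul (by simpa) (by simpa), abs_inv,
        show -(Real.log |R.det| + Real.log |R.det|) / 2 = -Real.log |R.det| by ring,
        Real.exp_neg, Real.exp_log (by positivity)]
    simp only [hg]
    rw [h1, h2, h3, mul_left_comm, mul_assoc, ← Real.exp_add, ← Real.exp_add]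
    congr 2
    ring
  refine Measure.ext_of_lintegral _ fun f hf => ?_
  have hL : Measurable fun y : EuclideanSpace ℝ ι => ENNReal.ofReal (Real.exp
        (-(Real.log S.det + (y.ofLp ⬝ᵥ S⁻¹ *ᵥ y.ofLp - y.ofLp ⬝ᵥ y.ofLp)) / 2)) := by
    simp only [dotProduct, mulVec]
    fun_prop
  simp only [multivariateGaussian, zero_add]
  rw [lintegral_map hf (by fun_prop), lintegral_withDensity_eq_lintegral_mul _ hL hf,
    stdGaussian_eq_withDensity, lintegral_withDensity_eq_lintegral_mul _ hgm (by fun_prop),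
    lintegral_withDensity_eq_lintegral_mul _ hgm (by fun_prop)]
  have h4 : ∀ x, ((fun x => ENNReal.ofReal (g x)) * fun a => f (T a)) x =
      (fun y => ENNReal.ofReal (g (T' y)) * f y) (T x) := by
    intro x; simp [hinv]
  rw [lintegral_congr h4, ← lintegral_map (g := T)
      (f := fun y => ENNReal.ofReal (g (T' y)) * f y) (by fun_prop) (by fun_prop), hmap,
    lintegral_smul_measure, smul_eq_mul, ← lintegral_const_mul _ (by fun_prop)]
  refine lintegral_congr fun y => ?_
  simp only [Pi.mul_apply]
  rw [← mul_assoc, ← mul_assoc, ← ENNReal.ofReal_mul (abs_nonneg _), key,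
    ENNReal.ofReal_mul (by positivity)]

end GaussianDensity

/-! ### Determinant and inverse of `Σ_S`, a rank-one perturbation of a diagonal matrix. -/

section CovMatrix

open Matrix

variable {n : ℕ} {ρ : ℝ} {s : Finset (Fin n)}

lemma covMatrix_eq_diagonal_add (ρ : ℝ) (s : Finset (Fin n)) :
    covMatrix ρ s = diagonal (fun i => if i ∈ s then 1 - ρ else 1) +
      ρ • vecMulVec (fun i => if i ∈ s then 1 else 0) (fun i => if i ∈ s then 1 else 0) := by
  ext i j
  by_cases hij : i = j
  · subst hij
    by_cases hi : i ∈ s <;> simp [covMatrix, vecMulVec_apply, hi]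
  · by_cases hi : i ∈ s <;> by_cases hj : j ∈ s <;> simp [covMatrix, vecMulVec_apply, hi, hj, hij]

lemma covMatrix_empty : covMatrix ρ (∅ : Finset (Fin n)) = 1 := by
  rw [covMatrix_eq_diagonal_add]
  ext i j
  simp [vecMulVec_apply, one_apply]

lemma covMatrix_posDef (h0 : 0 ≤ ρ) (h1 : ρ < 1) : (covMatrix ρ s).PosDef := by
  rw [covMatrix_eq_diagonal_add]
  refine PosDef.add_posSemidef (PosDef.diagonal fun i => ?_) (PosSemidef.smul ?_ h0)
  · split_ifs <;> linarith
  · simpa using posSemidef_vecMulVec_self_star (fun i => if i ∈ s then (1 : ℝ) else 0)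

/-- Matrix determinant lemma for the diagonal plus rank-one form. -/
lemma det_covMatrix (h1 : ρ < 1) :
    (covMatrix ρ s).det = (1 - ρ) ^ s.card * (1 + s.card * (ρ / (1 - ρ))) := by
  have hd : (diagonal (fun i => if i ∈ s then 1 - ρ else (1 : ℝ))).det = (1 - ρ) ^ s.card := by
    simp [det_diagonal]
  have h1' : 1 - ρ ≠ 0 := by linarith
  have hu : IsUnit (diagonal (fun i => if i ∈ s then 1 - ρ else (1 : ℝ))).det := by
    rw [hd]; exact (pow_ne_zero _ h1').isUnit
  have hinv : (diagonal (fun i => if i ∈ s then 1 - ρ else (1 : ℝ)))⁻¹ =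
      diagonal (fun i => if i ∈ s then (1 - ρ)⁻¹ else 1) := by
    refine inv_eq_right_inv ?_
    rw [diagonal_mul_diagonal, ← diagonal_one]
    congr 1
    ext i
    by_cases hi : i ∈ s <;> simp [hi, h1']
  rw [covMatrix_eq_diagonal_add, ← smul_vecMulVec, vecMulVec_eq Unit,
    det_add_replicateCol_mul_replicateRow hu, hd, hinv]
  congr 1
  simp [Matrix.mul_apply, diagonal_apply, det_unique]
  rw [Finset.sum_congr rfl fun x hx => by rw [if_pos hx, if_pos hx], Finset.sum_const, nsmul_eq_mul]
  ring

/-- The quadratic form of the inverse covariance matrix. -/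
lemma dotProduct_inv_covMatrix_mulVec (h0 : 0 ≤ ρ) (h1 : ρ < 1) (y : Fin n → ℝ) :
    y ⬝ᵥ (covMatrix ρ s)⁻¹ *ᵥ y - y ⬝ᵥ y =
      ρ / (1 - ρ) * ∑ i ∈ s, y i ^ 2 -
        ρ / ((1 - ρ) * (1 - ρ + s.card * ρ)) * (∑ i ∈ s, y i) ^ 2 := by
  set κ := ρ / ((1 - ρ) * (1 - ρ + s.card * ρ)) with hκ
  have h1' : 1 - ρ ≠ 0 := by linarith
  have h2 : 1 - ρ + s.card * ρ ≠ 0 := by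
    have : 0 ≤ s.card * ρ := by positivity
    linarith
  have h3 : 1 - ρ + ρ * s.card ≠ 0 := by rwa [mul_comm ρ]
  set u : Fin n → ℝ := fun i => if i ∈ s then 1 else 0 with hu
  -- Sherman–Morrison; `κ` is the resulting coefficient of the rank-one correction.
  have hinv : (covMatrix ρ s)⁻¹ =
      diagonal (fun i => if i ∈ s then (1 - ρ)⁻¹ else 1) - κ • vecMulVec u u := by
    refine inv_eq_right_inv ?_
    have huu : vecMulVec u u * vecMulVec u u = (s.card : ℝ) • vecMulVec u u := by
      rw [vecMulVec_mul_vecMulVec]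
      have : u ⬝ᵥ u = s.card := by simp [dotProduct, hu]
      rw [this]
      ext i j
      simp only [vecMulVec_apply, Matrix.smul_apply, Pi.smul_apply, smul_eq_mul]
      ring
    rw [covMatrix_eq_diagonal_add, mul_sub, add_mul, add_mul, Matrix.smul_mul, Matrix.mul_smul,
      Matrix.smul_mul, Matrix.mul_smul, huu, diagonal_mul_diagonal]
    ext i j
    by_cases hij : i = j
    · subst hij
      by_cases hi : i ∈ s
      · simp [vecMulVec_apply, hi, hu, hκ]
        field_simp
        ring
      · simp [vecMulVec_apply, hi, hu]
    · by_cases hi : i ∈ s <;> by_cases hj : j ∈ s <;> simp [vecMulVec_apply, hi, hj, hij, hu, hκ]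
      field_simp
      ring
  rw [hinv, sub_mulVec, smul_mulVec, dotProduct_sub, dotProduct_smul, vecMulVec_mulVec]
  have e1 : y ⬝ᵥ diagonal (fun i => if i ∈ s then (1 - ρ)⁻¹ else 1) *ᵥ y - y ⬝ᵥ y =
      ρ / (1 - ρ) * ∑ i ∈ s, y i ^ 2 := by
    simp only [dotProduct, mulVec_diagonal]
    rw [← Finset.sum_sub_distrib, Finset.mul_sum, ← Finset.sum_filter_add_sum_filter_not _ (· ∈ s)]
    rw [Finset.sum_eq_zero (s := Finset.univ.filter (¬ · ∈ s)), add_zero]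
    · rw [Finset.filter_mem_eq_inter, Finset.univ_inter]
      refine Finset.sum_congr rfl fun i hi => ?_
      rw [if_pos hi]
      field_simp
      ring
    · intro i hi
      simp [(Finset.mem_filter.1 hi).2]
  have e2 : u ⬝ᵥ y = ∑ i ∈ s, y i := by simp [dotProduct, hu]
  have e3 : y ⬝ᵥ u = ∑ i ∈ s, y i := by simp [dotProduct, hu]
  simp [e2, e3]
  linarith

end CovMatrix

/-- The log-likelihood ratio of `N(0, Σ_s)` against `N(0, I)`. -/
noncomputable def logLik {n : ℕ} (ρ : ℝ) (s : Finset (Fin n)) (y : EuclideanSpace ℝ (Fin n)) : ℝ :=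
  -(Real.log ((1 - ρ) ^ s.card * (1 + s.card * (ρ / (1 - ρ)))) +
    (ρ / (1 - ρ) * ∑ i ∈ s, y i ^ 2 -
      ρ / ((1 - ρ) * (1 - ρ + s.card * ρ)) * (∑ i ∈ s, y i) ^ 2)) / 2

/-- The divergence of `N(0, I)` from `N(0, Σ_s)` for a set `s` of `j` elements. -/
noncomputable def gaussDiv (ρ : ℝ) (j : ℕ) : ℝ :=
  (Real.log ((1 - ρ) ^ j * (1 + j * (ρ / (1 - ρ)))) +
    (ρ / (1 - ρ) * j - ρ / ((1 - ρ) * (1 - ρ + j * ρ)) * j)) / 2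

/-! ### Likelihood ratio of one masked observation. -/

section Observation

open Matrix WithLp
open scoped RealInnerProductSpace

variable {n : ℕ} {ρ : ℝ}

@[fun_prop]
lemma measurable_logLik (s : Finset (Fin n)) : Measurable (logLik ρ s) := by
  unfold logLik; fun_prop

@[fun_prop]
lemma measurable_mask (a : Finset (Fin n)) : Measurable (mask a) := by
  unfold mask
  refine (WithLp.measurable_toLp 2 _).comp (measurable_pi_lambda _ fun i => ?_)
  split_ifs <;> fun_prop

lemma vectorLaw_empty : vectorLaw ρ (∅ : Finset (Fin n)) = stdGaussian _ := by
  rw [vectorLaw, covMatrix_empty, multivariateGaussian_zero_one]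

instance (s : Finset (Fin n)) : IsProbabilityMeasure (vectorLaw ρ s) := by
  unfold vectorLaw; infer_instance

lemma vectorLaw_eq_withDensity (h0 : 0 ≤ ρ) (h1 : ρ < 1) (s : Finset (Fin n)) :
    vectorLaw ρ s = (vectorLaw ρ ∅).withDensity
      fun y => ENNReal.ofReal (Real.exp (logLik ρ s y)) := by
  rw [vectorLaw_empty, vectorLaw, multivariateGaussian_zero_eq_withDensity (covMatrix_posDef h0 h1)]
  simp_rw [dotProduct_inv_covMatrix_mulVec h0 h1, det_covMatrix h1]
  rfl

/-- Masking is self-adjoint, so characteristic functions are evaluated at vectors supported in `a`,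
where the quadratic forms of `Σ_S` and `Σ_{a ∩ S}` agree. -/
lemma map_mask_vectorLaw (h0 : 0 ≤ ρ) (h1 : ρ < 1) (a S : Finset (Fin n)) :
    (vectorLaw ρ S).map (mask a) = (vectorLaw ρ (a ∩ S)).map (mask a) := by
  have hself : ∀ x t : EuclideanSpace ℝ (Fin n), ⟪mask a x, t⟫ = ⟪x, mask a t⟫ := by
    intro x t
    simp only [PiLp.inner_apply, mask]
    refine Finset.sum_congr rfl fun i _ => ?_
    split_ifs <;> simp
  have hcf : ∀ (S : Finset (Fin n)) (t : EuclideanSpace ℝ (Fin n)),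
      charFun ((vectorLaw ρ S).map (mask a)) t = charFun (vectorLaw ρ S) (mask a t) := by
    intro S t
    rw [charFun_apply, charFun_apply, integral_map (by fun_prop)
      (Measurable.aestronglyMeasurable (by fun_prop))]
    simp_rw [hself]
  have (S : Finset (Fin n)) : IsProbabilityMeasure ((vectorLaw ρ S).map (mask a)) :=
    Measure.isProbabilityMeasure_map (by fun_prop)
  refine Measure.ext_of_charFun ?_
  ext t
  rw [hcf, hcf, vectorLaw, vectorLaw,
    charFun_multivariateGaussian (covMatrix_posDef h0 h1).posSemidef,
    charFun_multivariateGaussian (covMatrix_posDef h0 h1).posSemidef]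
  congr 4
  simp only [dotProduct, mulVec, mask, covMatrix, of_apply]
  refine Finset.sum_congr rfl fun i _ => ?_
  by_cases hi : i ∈ a
  · congr 1
    refine Finset.sum_congr rfl fun j _ => ?_
    by_cases hj : j ∈ a <;> simp [hi, hj]
  · simp [hi]

lemma logLik_inter_mask (a S : Finset (Fin n)) (y : EuclideanSpace ℝ (Fin n)) :
    logLik ρ (a ∩ S) (mask a y) = logLik ρ (a ∩ S) y := by
  have h : ∀ i ∈ a ∩ S, (mask a y) i = y i := fun i hi => by
    simp [mask, (Finset.mem_inter.1 hi).1]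
  unfold logLik
  rw [Finset.sum_congr rfl h, Finset.sum_congr rfl fun i hi => by rw [h i hi]]

lemma obsKernel_apply (S a : Finset (Fin n)) :
    obsKernel ρ S a = (vectorLaw ρ S).map (mask a) := rfl

instance (S : Finset (Fin n)) : IsMarkovKernel (obsKernel ρ S) :=
  ⟨fun a => by rw [obsKernel_apply]; exact Measure.isProbabilityMeasure_map (by fun_prop)⟩

lemma obsKernel_eq_withDensity (h0 : 0 ≤ ρ) (h1 : ρ < 1) (S a : Finset (Fin n)) :
    obsKernel ρ S a = (obsKernel ρ ∅ a).withDensity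
      fun y => ENNReal.ofReal (Real.exp (logLik ρ (a ∩ S) y)) := by
  rw [obsKernel_apply, obsKernel_apply, map_mask_vectorLaw h0 h1, vectorLaw_eq_withDensity h0 h1]
  refine Measure.ext_of_lintegral _ fun f hf => ?_
  rw [lintegral_map hf (by fun_prop), lintegral_withDensity_eq_lintegral_mul _ (by fun_prop)
    (by fun_prop), lintegral_withDensity_eq_lintegral_mul _ (by fun_prop) hf,
    lintegral_map (by fun_prop) (by fun_prop)]
  simp [logLik_inter_mask]

lemma integral_mul_stdGaussian (i j : Fin n) :
    Integrable (fun y : EuclideanSpace ℝ (Fin n) => y i * y j) (stdGaussian _) ∧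
    ∫ y : EuclideanSpace ℝ (Fin n), y i * y j ∂(stdGaussian _) = if i = j then 1 else 0 := by
  have hL (i : Fin n) : MemLp (fun y : EuclideanSpace ℝ (Fin n) => y i) 2 (stdGaussian _) := by
    have := (EuclideanSpace.proj i : EuclideanSpace ℝ (Fin n) →L[ℝ] ℝ).comp_memLp'
      (IsGaussian.memLp_two_id (μ := stdGaussian (EuclideanSpace ℝ (Fin n))))
    exact this
  refine ⟨(hL i).integrable_mul (hL j), ?_⟩
  have hz (i : Fin n) : ∫ y : EuclideanSpace ℝ (Fin n), y i ∂(stdGaussian _) = 0 :=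
    integral_strongDual_stdGaussian (EuclideanSpace.proj i : EuclideanSpace ℝ (Fin n) →L[ℝ] ℝ)
  have h := covariance_eval_multivariateGaussian (μ := 0) (S := (1 : Matrix (Fin n) (Fin n) ℝ))
    PosSemidef.one i j
  rw [multivariateGaussian_zero_one, covariance_eq_sub (hL i) (hL j), hz, hz] at h
  simpa [Matrix.one_apply] using h

/-- Under the null the coordinates are uncorrelated with unit variance, so `∑ y_i²` and `(∑ y_i)²`
both have mean `|s|`. -/
lemma integral_logLik (s : Finset (Fin n)) :
    Integrable (logLik ρ s) (stdGaussian _) ∧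
    ∫ y, logLik ρ s y ∂(stdGaussian _) = -gaussDiv ρ s.card := by
  have e : logLik ρ s = fun y =>
      -(Real.log ((1 - ρ) ^ s.card * (1 + s.card * (ρ / (1 - ρ)))) +
    (ρ / (1 - ρ) * ∑ i ∈ s, y i * y i -
      ρ / ((1 - ρ) * (1 - ρ + s.card * ρ)) * (∑ i ∈ s, ∑ j ∈ s, y i * y j))) / 2 := by
    ext y
    simp only [logLik, Finset.sum_mul_sum, pow_two]
  have i1 : Integrable (fun y : EuclideanSpace ℝ (Fin n) => ∑ i ∈ s, y i * y i) (stdGaussian _) :=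
    integrable_finsetSum _ fun i _ => (integral_mul_stdGaussian i i).1
  have i2 : Integrable (fun y : EuclideanSpace ℝ (Fin n) => ∑ i ∈ s, ∑ j ∈ s, y i * y j)
      (stdGaussian _) :=
    integrable_finsetSum _ fun i _ => integrable_finsetSum _ fun j _ =>
      (integral_mul_stdGaussian i j).1
  have i3 : Integrable (fun y : EuclideanSpace ℝ (Fin n) => ρ / (1 - ρ) * ∑ i ∈ s, y i * y i -
      ρ / ((1 - ρ) * (1 - ρ + s.card * ρ)) * (∑ i ∈ s, ∑ j ∈ s, y i * y j)) (stdGaussian _) := (i1.const_mul (ρ / (1 - ρ))).sub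
    (i2.const_mul (ρ / ((1 - ρ) * (1 - ρ + s.card * ρ))))
  rw [e]
  refine ⟨((integrable_const _).add i3).neg.div_const 2, ?_⟩
  rw [integral_div, integral_neg, integral_add (integrable_const _) i3,
    integral_sub (i1.const_mul _) (i2.const_mul _), integral_const_mul, integral_const_mul,
    integral_finsetSum _ fun i _ => (integral_mul_stdGaussian i i).1,
    integral_finsetSum _ fun i _ => integrable_finsetSum _ fun j _ =>
      (integral_mul_stdGaussian i j).1]
  simp_rw [integral_finsetSum s fun j _ => (integral_mul_stdGaussian _ j).1,
    (integral_mul_stdGaussian _ _).2]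
  simp [gaussDiv]
  ring

lemma integral_logLik_obsKernel (a S : Finset (Fin n)) :
    Integrable (logLik ρ (a ∩ S)) (obsKernel ρ ∅ a) ∧
    ∫ y, logLik ρ (a ∩ S) y ∂(obsKernel ρ ∅ a) = -gaussDiv ρ (a ∩ S).card := by
  rw [obsKernel_apply, vectorLaw_empty, integral_map (by fun_prop) (by fun_prop),
    integrable_map_measure (by fun_prop) (by fun_prop)]
  simp only [Function.comp_def, logLik_inter_mask]
  exact integral_logLik _

end Observation

/-! ### Scalar bounds on the Gaussian divergence. -/

section RealBounds

lemma log_one_sub_le {ρ : ℝ} (h0 : 0 ≤ ρ) (h1 : ρ < 1) : Real.log (1 - ρ) ≤ -ρ - ρ ^ 2 / 2 := by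
  have h := sum_le_hasSum (Finset.range 2) (fun i _ => by positivity)
    (Real.hasSum_pow_div_log_of_abs_lt_one (x := ρ) (by rwa [abs_of_nonneg h0]))
  norm_num [Finset.sum_range_succ] at h
  linarith

/-- Two upper bounds for `log (1 + x) - x / (1 + x)`. -/
lemma log_one_add_sub_le {x : ℝ} (hx : 0 ≤ x) :
    Real.log (1 + x) - x / (1 + x) ≤ min (x / 4) (x ^ 2 / 2) := by
  set r := √(1 + x) with hr
  have hr2 : r ^ 2 = 1 + x := Real.sq_sqrt (by linarith)
  have hr1 : 1 ≤ r := Real.one_le_sqrt.2 (by linarith)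
  have hr0 : 0 < r := by linarith
  -- This is `u ≤ sinh u` at `u = log r`. Doubled, it bounds `log (1 + x)` by `r - r⁻¹`, so the
  -- difference is at most `x (t - t²)` with `t = r⁻¹`.
  have hs : Real.log r ≤ (r - r⁻¹) / 2 := by
    rw [← Real.sinh_log hr0]
    exact Real.self_le_sinh_iff.2 (Real.log_nonneg hr1)
  have hlog : Real.log (1 + x) ≤ r - r⁻¹ := by
    rw [← hr2, Real.log_pow]
    push_cast
    linarith
  have hx' : x = r ^ 2 - 1 := by linarith
  set t := r⁻¹ with ht
  have hrt : r * t = 1 := mul_inv_cancel₀ hr0.ne'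
  have ht0 : 0 < t := by positivity
  have ht1 : t ≤ 1 := inv_le_one_of_one_le₀ hr1
  have hdiv : x / (1 + x) = 1 - t ^ 2 := by
    rw [← hr2, hx', ht]
    field_simp
  have hrt' : r - t = x * t := by rw [hx']; linear_combination -r * hrt
  have h1 : 1 - t ^ 2 = x * t ^ 2 := by
    rw [hx']; linear_combination (-(r * t) - 1) * hrt
  have hle : Real.log (1 + x) - x / (1 + x) ≤ x * (t - t ^ 2) := by
    rw [hdiv, h1]; linarith
  refine hle.trans (le_min ?_ ?_)
  · nlinarith [sq_nonneg (t - 1 / 2)]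
  · have h2 : t - t ^ 2 ≤ x / 2 := by
      have : 1 - t ≤ x / 2 := by
        rw [hx']
        nlinarith [sq_nonneg (r - 1), mul_nonneg (sub_nonneg.2 hr1) (sub_nonneg.2 ht1)]
      nlinarith
    nlinarith

lemma divBound_nonneg {ρ : ℝ} (h0 : 0 ≤ ρ) (h1 : ρ < 1) (k : ℕ) : 0 ≤ divBound ρ k :=
  le_min (div_nonneg h0 (by linarith)) (by positivity)

/-- The bound is linear in `j`, so the cost of a query is charged coordinate by coordinate. The two
entries of the minimum come from the two bounds of `log_one_add_sub_le`. -/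
lemma gaussDiv_le {ρ : ℝ} (h0 : 0 ≤ ρ) (h2 : ρ ≤ 1 / 2) {j k : ℕ} (hjk : j ≤ k) :
    gaussDiv ρ j ≤ j * (divBound ρ k / 2) := by
  obtain _ | i := j
  · simp [gaussDiv]
  have hq : 0 < 1 - ρ := by linarith
  -- With `j = i + 1`, the spectrum of `Σ` on the set is `1 - ρ` with multiplicity `i`, and `1 + x`.
  set x : ℝ := i * ρ with hx
  have hx0 : 0 ≤ x := by positivity
  have e1 : (1 - ρ) ^ (i + 1) * (1 + ((i + 1 : ℕ) : ℝ) * (ρ / (1 - ρ))) =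
      (1 - ρ) ^ i * (1 + x) := by
    push_cast
    field_simp
    ring
  have e2 : ρ / (1 - ρ) * ((i + 1 : ℕ) : ℝ) -
      ρ / ((1 - ρ) * (1 - ρ + ((i + 1 : ℕ) : ℝ) * ρ)) * ((i + 1 : ℕ) : ℝ) =
      i * (ρ / (1 - ρ)) - x / (1 + x) := by
    have : (1 - ρ + ((i + 1 : ℕ) : ℝ) * ρ) = 1 + x := by push_cast; ring
    rw [this]
    push_cast
    field_simp
    rw [hx]
    ring
  have hlog := log_one_sub_le h0 (by linarith : ρ < 1)
  have hl := log_one_add_sub_le hx0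
  have hmain : 2 * gaussDiv ρ (i + 1) ≤
      i * (-ρ - ρ ^ 2 / 2 + ρ / (1 - ρ)) + min (x / 4) (x ^ 2 / 2) := by
    rw [gaussDiv, e1, e2, Real.log_mul (by positivity) (by positivity), Real.log_pow]
    have := mul_le_mul_of_nonneg_left hlog (Nat.cast_nonneg (α := ℝ) i)
    linarith
  have hi : (0 : ℝ) ≤ i := Nat.cast_nonneg i
  have hik : (i : ℝ) + 1 ≤ k := by exact_mod_cast hjk
  have hA : 2 * gaussDiv ρ (i + 1) ≤ (i + 1) * (ρ / (2 * (1 - ρ))) := by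
    -- The term `ρ / 4` is the share of `x / 4` per unit of `i`. The gap has the factor `1 - 2ρ`,
    -- hence the restriction `ρ ≤ 1/2`.
    have h3 : -ρ - ρ ^ 2 / 2 + ρ / (1 - ρ) + ρ / 4 ≤ ρ / (2 * (1 - ρ)) := by
      rw [← sub_nonneg]
      have : ρ / (2 * (1 - ρ)) - (-ρ - ρ ^ 2 / 2 + ρ / (1 - ρ) + ρ / 4) =
          ρ * ((1 - 2 * ρ) * (1 + ρ)) / (4 * (1 - ρ)) := by
        field_simp
        ring
      rw [this]
      have : 0 ≤ 1 - 2 * ρ := by linarith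
      positivity
    have h4 : 0 ≤ ρ / (2 * (1 - ρ)) := by positivity
    have := mul_le_mul_of_nonneg_left h3 hi
    have := min_le_left (x / 4) (x ^ 2 / 2)
    nlinarith
  have hB : 2 * gaussDiv ρ (i + 1) ≤ (i + 1) * (ρ ^ 2 * (k + 1)) := by
    have h3 : -ρ - ρ ^ 2 / 2 + ρ / (1 - ρ) ≤ 3 / 2 * ρ ^ 2 := by
      rw [← sub_nonneg]
      have : 3 / 2 * ρ ^ 2 - (-ρ - ρ ^ 2 / 2 + ρ / (1 - ρ)) =
          ρ ^ 2 * (1 - 2 * ρ) / (1 - ρ) := by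
        field_simp
        ring
      rw [this]
      have : 0 ≤ 1 - 2 * ρ := by linarith
      positivity
    have h4 := mul_le_mul_of_nonneg_left h3 hi
    have h5 := min_le_right (x / 4) (x ^ 2 / 2)
    have h6 : (i + 1) * (ρ ^ 2 * (i + 2)) ≤ (i + 1) * (ρ ^ 2 * (k + 1)) := by
      have : (i : ℝ) + 2 ≤ k + 1 := by linarith
      gcongr
    have h7 : i * (3 / 2 * ρ ^ 2) + x ^ 2 / 2 ≤ (i + 1) * (ρ ^ 2 * (i + 2)) := by
      rw [hx]
      nlinarith [sq_nonneg ρ, mul_nonneg hi (sq_nonneg ρ), mul_nonneg (mul_nonneg hi hi) (sq_nonneg ρ)]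
    linarith
  have : 2 * gaussDiv ρ (i + 1) ≤ (i + 1) * divBound ρ k := by
    rw [divBound, mul_min_of_nonneg _ _ (by positivity)]
    exact le_min hA hB
  push_cast
  linarith

end RealBounds

/-! ### Jensen's inequality and the Hellinger bound on testing errors. -/

section Inequalities

variable {α : Type*} [MeasurableSpace α]

/-- Jensen's inequality for the exponential function, without integrability of `exp ∘ g`. -/
lemma ofReal_exp_integral_le_lintegral {μ : Measure α} [IsProbabilityMeasure μ] {g : α → ℝ}
    (hg : Integrable g μ) :
    ENNReal.ofReal (Real.exp (∫ x, g x ∂μ)) ≤ ∫⁻ x, ENNReal.ofReal (Real.exp (g x)) ∂μ := by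
  have h0 : 0 ≤ᵐ[μ] fun x => Real.exp (g x) := ae_of_all _ fun x => (Real.exp_pos _).le
  by_cases hfin : ∫⁻ x, ENNReal.ofReal (Real.exp (g x)) ∂μ = ∞
  · rw [hfin]; exact le_top
  have hint : Integrable (fun x => Real.exp (g x)) μ :=
    ⟨Real.continuous_exp.comp_aestronglyMeasurable hg.1,
      (hasFiniteIntegral_iff_ofReal h0).2 (lt_top_iff_ne_top.2 hfin)⟩
  rw [← ofReal_integral_eq_lintegral_ofReal hint h0]
  exact ENNReal.ofReal_le_ofReal (convexOn_exp.map_integral_le Real.continuous_exp.continuousOn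
    isClosed_univ (by simp) hg hint)

/-- Cauchy–Schwarz on `A` for the product `1 · exp (g / 2)`. -/
lemma sq_setLIntegral_exp_half_le {μ : Measure α} {g : α → ℝ} (hg : Measurable g)
    {A : Set α} (hA : MeasurableSet A) :
    (∫⁻ x in A, ENNReal.ofReal (Real.exp (g x / 2)) ∂μ) ^ 2 ≤
      μ A * μ.withDensity (fun x => ENNReal.ofReal (Real.exp (g x))) A := by
  have h := ENNReal.lintegral_mul_le_Lp_mul_Lq (μ.restrict A) Real.HolderConjugate.two_two
    (f := fun _ => 1) (g := fun x => ENNReal.ofReal (Real.exp (g x / 2)))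
    (by fun_prop) (by fun_prop)
  have e : ∀ x, ENNReal.ofReal (Real.exp (g x / 2)) ^ (2 : ℝ) = ENNReal.ofReal (Real.exp (g x)) := by
    intro x
    rw [ENNReal.rpow_two, ← ENNReal.ofReal_pow (Real.exp_pos _).le, ← Real.exp_nat_mul]
    congr 2
    push_cast
    ring
  simp only [Pi.mul_apply, one_mul, ENNReal.one_rpow, lintegral_const, Measure.restrict_apply_univ,
    e] at h
  refine (pow_le_pow_left' h 2).trans_eq ?_
  rw [withDensity_apply _ hA, mul_pow, ← ENNReal.rpow_natCast, ← ENNReal.rpow_natCast,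
    ← ENNReal.rpow_mul, ← ENNReal.rpow_mul]
  norm_num

/-- Lower bound for the sum of the two error probabilities of a test in terms of the Hellinger
affinity. -/
lemma sq_lintegral_exp_half_le {P Q : Measure α} [IsProbabilityMeasure P] [IsProbabilityMeasure Q]
    {g : α → ℝ} (hg : Measurable g)
    (hQ : Q = P.withDensity fun x => ENNReal.ofReal (Real.exp (g x)))
    {A : Set α} (hA : MeasurableSet A) :
    (∫⁻ x, ENNReal.ofReal (Real.exp (g x / 2)) ∂P) ^ 2 ≤ 2 * (P A + Q Aᶜ) := by
  have h1 := sq_setLIntegral_exp_half_le (μ := P) hg hA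
  have h2 := sq_setLIntegral_exp_half_le (μ := P) hg hA.compl
  rw [← hQ] at h1 h2
  rw [← lintegral_add_compl _ hA]
  set a := ∫⁻ x in A, ENNReal.ofReal (Real.exp (g x / 2)) ∂P
  set b := ∫⁻ x in Aᶜ, ENNReal.ofReal (Real.exp (g x / 2)) ∂P
  -- On the rejection region the factor `Q A` is discarded, on its complement `P Aᶜ`, which leaves
  -- exactly the two error probabilities.
  have h1' : a ^ 2 ≤ P A := h1.trans (mul_le_of_le_one_right' prob_le_one)
  have h2' : b ^ 2 ≤ Q Aᶜ := h2.trans (mul_le_of_le_one_left' prob_le_one)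
  have h3 : (a + b) ^ 2 ≤ 2 * (a ^ 2 + b ^ 2) := by
    have := ENNReal.rpow_add_le_mul_rpow_add_rpow a b (p := 2) (by norm_num)
    norm_num at this
    exact this
  exact h3.trans (by gcongr)

end Inequalities

/-! ### The law of the adaptive history: budget, likelihood ratio, submartingale. -/

section Law

variable {n M : ℕ} {ρ : ℝ}

lemma measurable_snoc (t : ℕ) :
    Measurable fun p : History n t × (Finset (Fin n) × EuclideanSpace ℝ (Fin n)) =>
      (Fin.snoc p.1 p.2 : History n (t + 1)) := by
  refine measurable_pi_lambda _ fun i => ?_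
  induction i using Fin.lastCases with
  | last => simpa using measurable_snd
  | cast i =>
    simp only [Fin.snoc_castSucc]
    exact (measurable_pi_apply i).comp measurable_fst

instance (A : SensingStrategy n M) (t : ℕ) : IsMarkovKernel (A.query t) := A.isMarkov t

instance isProbabilityMeasure_law (A : SensingStrategy n M) (S : Finset (Fin n)) :
    (t : ℕ) → IsProbabilityMeasure (A.law ρ S t)
  | 0 => by unfold SensingStrategy.law; infer_instance
  | t + 1 => by
    have := isProbabilityMeasure_law A S t
    unfold SensingStrategy.law
    exact Measure.isProbabilityMeasure_map (measurable_snoc t).aemeasurable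

lemma lintegral_law_succ (A : SensingStrategy n M) (S : Finset (Fin n)) (t : ℕ)
    {F : History n (t + 1) → ℝ≥0∞} (hF : Measurable F) :
    ∫⁻ h, F h ∂(A.law ρ S (t + 1)) =
      ∫⁻ h, ∫⁻ a, ∫⁻ x, F (Fin.snoc h (a, x)) ∂(obsKernel ρ S a) ∂(A.query t h) ∂(A.law ρ S t) := by
  have hm : Measurable fun p : History n t × (Finset (Fin n) × EuclideanSpace ℝ (Fin n)) =>
      F (Fin.snoc p.1 p.2) := hF.comp (measurable_snoc t)
  rw [SensingStrategy.law, lintegral_map hF (measurable_snoc t), Measure.lintegral_compProd hm]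
  refine lintegral_congr fun h => ?_
  exact Kernel.lintegral_compProd _ _ _ (hm.comp measurable_prodMk_left)

lemma measurable_spent (t : ℕ) : Measurable (spent : History n t → ℕ) := by
  unfold spent
  refine Finset.measurable_sum _ fun j _ => ?_
  exact (Measurable.of_discrete (f := fun a : Finset (Fin n) => a.card)).comp
    (measurable_fst.comp (measurable_pi_apply j))

lemma spent_snoc {t : ℕ} (h : History n t) (p : Finset (Fin n) × EuclideanSpace ℝ (Fin n)) :
    spent (Fin.snoc h p : History n (t + 1)) = spent h + p.1.card := by
  simp [spent, Fin.sum_univ_castSucc]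

/-- The budget condition constrains a round only after histories still within budget, so it has to
be propagated by induction. -/
lemma ae_spent_le (A : SensingStrategy n M) (S : Finset (Fin n)) {t : ℕ} (ht : t ≤ M) :
    ∀ᵐ h ∂(A.law ρ S t), spent h ≤ M := by
  induction t with
  | zero => exact ae_of_all _ fun h => by simp [spent]
  | succ t ih =>
    have hms : MeasurableSet {h : History n (t + 1) | ¬ spent h ≤ M} :=
      measurable_spent _ (MeasurableSet.of_discrete (s := {m : ℕ | ¬ m ≤ M}))
    rw [ae_iff, ← lintegral_indicator_one hms,
      lintegral_law_succ _ _ _ (measurable_one.indicator hms)]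
    refine (lintegral_congr_ae ?_).trans lintegral_zero
    filter_upwards [ih (by omega)] with h hh
    refine (lintegral_congr_ae ?_).trans lintegral_zero
    filter_upwards [A.budget t (by omega) h hh] with a ha
    refine (lintegral_congr fun x => ?_).trans lintegral_zero
    simp [spent_snoc, ha]

/-- The log-likelihood ratio of a history. -/
noncomputable def historyLogLik (ρ : ℝ) (S : Finset (Fin n)) {t : ℕ} (h : History n t) : ℝ :=
  ∑ j, logLik ρ ((h j).1 ∩ S) (h j).2

lemma measurable_logLik_inter (S : Finset (Fin n)) :
    Measurable fun p : Finset (Fin n) × EuclideanSpace ℝ (Fin n) => logLik ρ (p.1 ∩ S) p.2 :=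
  measurable_from_prod_countable_right fun a => measurable_logLik (a ∩ S)

lemma measurable_sum_history {g : Finset (Fin n) × EuclideanSpace ℝ (Fin n) → ℝ}
    (hg : Measurable g) (t : ℕ) : Measurable fun h : History n t => ∑ j, g (h j) :=
  Finset.measurable_sum _ fun j _ => hg.comp (measurable_pi_apply j)

lemma measurable_historyLogLik (S : Finset (Fin n)) (t : ℕ) :
    Measurable (historyLogLik ρ S : History n t → ℝ) :=
  measurable_sum_history (measurable_logLik_inter S) t

/-- Both laws use the same query kernels, so each round multiplies the density only by the
likelihood ratio of its observation. -/
lemma law_eq_withDensity (h0 : 0 ≤ ρ) (h1 : ρ < 1) (A : SensingStrategy n M)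
    (S : Finset (Fin n)) (t : ℕ) :
    A.law ρ S t = (A.law ρ ∅ t).withDensity
      fun h => ENNReal.ofReal (Real.exp (historyLogLik ρ S h)) := by
  induction t with
  | zero => simp [SensingStrategy.law, historyLogLik]
  | succ t ih =>
    have hm (t : ℕ) : Measurable fun h : History n t =>
        ENNReal.ofReal (Real.exp (historyLogLik ρ S h)) := by
      have := measurable_historyLogLik (ρ := ρ) S t
      fun_prop
    refine Measure.ext_of_lintegral _ fun F hF => ?_
    rw [lintegral_law_succ _ _ _ hF, lintegral_withDensity_eq_lintegral_mul _ (hm _) hF,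
      lintegral_law_succ _ _ _ ((hm _).mul hF), ih,
      lintegral_withDensity_eq_lintegral_mul_non_measurable _ (hm _)
        (ae_of_all _ fun _ => ENNReal.ofReal_lt_top)]
    refine lintegral_congr fun h => ?_
    rw [Pi.mul_apply, ← lintegral_const_mul' _ _ ENNReal.ofReal_ne_top]
    refine lintegral_congr fun a => ?_
    rw [← lintegral_const_mul' _ _ ENNReal.ofReal_ne_top, obsKernel_eq_withDensity h0 h1 S a,
      lintegral_withDensity_eq_lintegral_mul_non_measurable _ (by fun_prop)
        (ae_of_all _ fun _ => ENNReal.ofReal_lt_top)]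
    refine lintegral_congr fun x => ?_
    simp only [Pi.mul_apply]
    rw [mul_left_comm, ← mul_assoc, ← ENNReal.ofReal_mul (Real.exp_pos _).le, ← Real.exp_add]
    simp [historyLogLik, Fin.sum_univ_castSucc, add_comm]

/-- If the exponential of `g` has conditional mean at least one given each query, then the product
of these exponentials along the history has mean at least one. -/
lemma one_le_lintegral_exp_sum (A : SensingStrategy n M) (S : Finset (Fin n))
    {g : Finset (Fin n) × EuclideanSpace ℝ (Fin n) → ℝ} (hg : Measurable g)
    (h1 : ∀ a, 1 ≤ ∫⁻ x, ENNReal.ofReal (Real.exp (g (a, x))) ∂(obsKernel ρ S a)) (t : ℕ) :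
    1 ≤ ∫⁻ h, ENNReal.ofReal (Real.exp (∑ j, g (h j))) ∂(A.law ρ S t) := by
  induction t with
  | zero => simp
  | succ t ih =>
    have hm := measurable_sum_history (n := n) hg (t + 1)
    rw [lintegral_law_succ _ _ _ (by fun_prop)]
    refine ih.trans (lintegral_mono fun h => ?_)
    have e (a x) : ENNReal.ofReal (Real.exp (∑ j, g ((Fin.snoc h (a, x) : History n (t + 1)) j))) =
        ENNReal.ofReal (Real.exp (∑ j, g (h j))) * ENNReal.ofReal (Real.exp (g (a, x))) := by
      rw [← ENNReal.ofReal_mul (Real.exp_pos _).le, ← Real.exp_add]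
      simp [Fin.sum_univ_castSucc]
    simp_rw [e, lintegral_const_mul' _ _ ENNReal.ofReal_ne_top]
    calc ENNReal.ofReal (Real.exp (∑ j, g (h j)))
        = ENNReal.ofReal (Real.exp (∑ j, g (h j))) * ∫⁻ a, 1 ∂(A.query t h) := by simp
      _ ≤ _ := by gcongr; exact h1 _

end Law

/-! ### Risk bound from a disjoint family. -/

section LowerBound

variable {n M : ℕ} {ρ : ℝ}

/-- Given any query, the normalized geometric mean over a disjoint family of the square roots of the
likelihood ratios of one observation has mean at least one under the null. -/
lemma one_le_lintegral_exp_mean_logLik {k N : ℕ} (h0 : 0 ≤ ρ) (h2 : ρ ≤ 1 / 2)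
    {B : Fin N → Finset (Fin n)} (hdisj : Pairwise fun i j => Disjoint (B i) (B j))
    (hcard : ∀ j, (B j).card ≤ k) (a : Finset (Fin n)) :
    1 ≤ ∫⁻ x, ENNReal.ofReal (Real.exp (∑ j, (2 * N : ℝ)⁻¹ * logLik ρ (a ∩ B j) x +
      divBound ρ k / (4 * N) * a.card)) ∂(obsKernel ρ ∅ a) := by
  have hD := divBound_nonneg h0 (by linarith) k
  have hi1 : ∀ j ∈ Finset.univ, Integrable (fun x => (2 * N : ℝ)⁻¹ * logLik ρ (a ∩ B j) x)
      (obsKernel ρ ∅ a) := fun j _ => (integral_logLik_obsKernel a (B j)).1.const_mul _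
  have hi := (integrable_finsetSum _ hi1).add
    (integrable_const (μ := obsKernel ρ ∅ a) (divBound ρ k / (4 * N) * a.card))
  refine le_trans ?_ (ofReal_exp_integral_le_lintegral hi)
  rw [ENNReal.one_le_ofReal, Real.one_le_exp_iff,
    integral_add (integrable_finsetSum _ hi1) (integrable_const _), integral_finsetSum _ hi1]
  simp_rw [integral_const_mul, (integral_logLik_obsKernel a (B _)).2]
  -- Disjointness: each measured coordinate informs about at most one block, so averaging over the
  -- family gains a factor `1/N`.
  have hsum : ∑ j, (a ∩ B j).card ≤ a.card := by
    rw [← Finset.card_biUnion fun i _ j _ hij =>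
      (hdisj hij).mono Finset.inter_subset_right Finset.inter_subset_right]
    exact Finset.card_le_card (Finset.biUnion_subset.2 fun j _ => Finset.inter_subset_left)
  have hsum' : ∑ j, ((a ∩ B j).card : ℝ) ≤ a.card := by exact_mod_cast hsum
  have hle : ∑ j, gaussDiv ρ (a ∩ B j).card ≤ a.card * (divBound ρ k / 2) :=
    calc ∑ j, gaussDiv ρ (a ∩ B j).card
        ≤ ∑ j, ((a ∩ B j).card : ℝ) * (divBound ρ k / 2) := Finset.sum_le_sum fun j _ =>
          gaussDiv_le h0 h2 ((Finset.card_le_card Finset.inter_subset_right).trans (hcard j))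
      _ ≤ a.card * (divBound ρ k / 2) := by
        rw [← Finset.sum_mul]
        gcongr
  have hle' := mul_le_mul_of_nonneg_left hle (by positivity : (0 : ℝ) ≤ (2 * N : ℝ)⁻¹)
  simp only [mul_neg, Finset.sum_neg_distrib, ← Finset.mul_sum, integral_const, probReal_univ,
    one_smul]
  have : (2 * N : ℝ)⁻¹ * (a.card * (divBound ρ k / 2)) = divBound ρ k / (4 * N) * a.card := by
    rw [mul_inv, div_mul_eq_div_div]
    ring
  linarith

lemma sq_lintegral_le_two_mul_risk (h0 : 0 ≤ ρ) (h1 : ρ < 1) {C : Set (Finset (Fin n))}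
    {S : Finset (Fin n)} (hS : S ∈ C) (A : SensingStrategy n M) {φ : History n M → Bool}
    (hφ : Measurable φ) :
    (∫⁻ h, ENNReal.ofReal (Real.exp (historyLogLik ρ S h / 2)) ∂(A.law ρ ∅ M)) ^ 2 ≤
      2 * risk ρ C A φ := by
  have hA : MeasurableSet {z | φ z ≠ false} :=
    hφ (MeasurableSet.of_discrete (s := {b : Bool | b ≠ false}))
  refine (sq_lintegral_exp_half_le (measurable_historyLogLik S M)
    (law_eq_withDensity h0 h1 A S M) hA).trans ?_
  have hc : {z | φ z ≠ false}ᶜ = {z | φ z ≠ true} := by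
    ext z; cases h : φ z <;> simp [h]
  rw [hc]
  unfold risk
  gcongr
  exact le_iSup₂ (f := fun S (_ : S ∈ C) => A.law ρ S M {z | φ z ≠ true}) S hS

/-- The risk is bounded below as soon as the class contains a disjoint family of sets. -/
lemma exp_le_two_mul_risk {k N : ℕ} (h0 : 0 ≤ ρ) (h2 : ρ ≤ 1 / 2) (hN : 0 < N)
    {C : Set (Finset (Fin n))} {B : Fin N → Finset (Fin n)} (hB : ∀ j, B j ∈ C)
    (hdisj : Pairwise fun i j => Disjoint (B i) (B j)) (hcard : ∀ j, (B j).card ≤ k)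
    (A : SensingStrategy n M) {φ : History n M → Bool} (hφ : Measurable φ) :
    ENNReal.ofReal (Real.exp (-(divBound ρ k * M / (2 * N)))) ≤ 2 * risk ρ C A φ := by
  have hD := divBound_nonneg h0 (by linarith) k
  have hN' : (N : ℝ) ≠ 0 := by positivity
  -- Compensator per measured coordinate: the weight `1/(2N)` times the divergence cost `D/2`.
  set c := divBound ρ k / (4 * N) with hc
  have hc0 : 0 ≤ c := by positivity
  set E := ENNReal.ofReal (Real.exp (c * M)) with hE
  set r := 2 * risk ρ C A φ with hr
  set I : Fin N → ℝ≥0∞ := fun j =>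
    ∫⁻ h, ENNReal.ofReal (Real.exp (historyLogLik ρ (B j) h / 2)) ∂(A.law ρ ∅ M) with hI
  have hI2 : ∀ j, I j ≤ r ^ (1 / 2 : ℝ) := fun j => by
    have := ENNReal.rpow_le_rpow (sq_lintegral_le_two_mul_risk h0 (by linarith) (hB j) A hφ)
      (by norm_num : (0 : ℝ) ≤ 1 / 2)
    rwa [← ENNReal.rpow_natCast, ← ENNReal.rpow_mul,
      show ((2 : ℕ) : ℝ) * (1 / 2) = 1 by norm_num, ENNReal.rpow_one] at this
  have hgm : Measurable fun p : Finset (Fin n) × EuclideanSpace ℝ (Fin n) =>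
      ∑ j, (2 * N : ℝ)⁻¹ * logLik ρ (p.1 ∩ B j) p.2 + c * p.1.card := by
    refine (Finset.measurable_sum _ fun j _ => (measurable_logLik_inter (B j)).const_mul _).add ?_
    exact ((Measurable.of_discrete (f := fun a : Finset (Fin n) => (a.card : ℝ))).comp
      measurable_fst).const_mul _
  have h1 : 1 ≤ E * r ^ (1 / 2 : ℝ) := by
    calc 1 ≤ ∫⁻ h, ENNReal.ofReal (Real.exp (∑ t, (∑ j, (2 * N : ℝ)⁻¹ *
            logLik ρ ((h t).1 ∩ B j) (h t).2 + c * (h t).1.card))) ∂(A.law ρ ∅ M) :=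
          one_le_lintegral_exp_sum A ∅ hgm
            (one_le_lintegral_exp_mean_logLik h0 h2 hdisj hcard) M
      _ ≤ ∫⁻ h, E * ∑ j, ENNReal.ofReal (N : ℝ)⁻¹ *
            ENNReal.ofReal (Real.exp (historyLogLik ρ (B j) h / 2)) ∂(A.law ρ ∅ M) := by
          refine lintegral_mono_ae ?_
          filter_upwards [ae_spent_le A ∅ le_rfl] with h hh
          have e1 : ∑ t, (∑ j, (2 * N : ℝ)⁻¹ * logLik ρ ((h t).1 ∩ B j) (h t).2 +
              c * (h t).1.card) =
              c * spent h + ∑ j, (N : ℝ)⁻¹ • (historyLogLik ρ (B j) h / 2) := by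
            rw [Finset.sum_add_distrib, Finset.sum_comm, ← Finset.mul_sum, add_comm]
            congr 1
            · simp [spent]
            · refine Finset.sum_congr rfl fun j _ => ?_
              rw [historyLogLik, smul_eq_mul, ← Finset.mul_sum]
              field_simp
          -- The geometric mean of the `exp (L_B / 2)` is at most their arithmetic mean, which
          -- passes from the compensated product to the affinities.
          have e2 := convexOn_exp.map_sum_le (t := Finset.univ) (w := fun _ : Fin N => (N : ℝ)⁻¹)
            (p := fun j => historyLogLik ρ (B j) h / 2) (fun _ _ => by positivity)
            (by simp [hN']) (by simp)
          rw [e1, Real.exp_add, ENNReal.ofReal_mul (Real.exp_pos _).le]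
          gcongr
          · exact ENNReal.ofReal_le_ofReal (Real.exp_le_exp.2 (by gcongr))
          · refine (ENNReal.ofReal_le_ofReal e2).trans_eq ?_
            rw [ENNReal.ofReal_sum_of_nonneg fun _ _ => by positivity]
            exact Finset.sum_congr rfl fun j _ => ENNReal.ofReal_mul (by positivity)
      _ = E * ∑ j, ENNReal.ofReal (N : ℝ)⁻¹ * I j := by
          have hm (j : Fin N) : Measurable fun h : History n M =>
              ENNReal.ofReal (Real.exp (historyLogLik ρ (B j) h / 2)) := by
            have := measurable_historyLogLik (ρ := ρ) (B j) M
            fun_prop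
          rw [lintegral_const_mul' _ _ ENNReal.ofReal_ne_top,
            lintegral_finsetSum _ fun j _ => (hm j).const_mul _]
          simp_rw [lintegral_const_mul' _ _ ENNReal.ofReal_ne_top]
          rfl
      _ ≤ E * ∑ j : Fin N, ENNReal.ofReal (N : ℝ)⁻¹ * r ^ (1 / 2 : ℝ) := by
          gcongr
          exact hI2 _
      _ = E * r ^ (1 / 2 : ℝ) := by
          rw [Finset.sum_const, Finset.card_univ, Fintype.card_fin, nsmul_eq_mul,
            ← mul_assoc (N : ℝ≥0∞), ← ENNReal.ofReal_natCast, ← ENNReal.ofReal_mul (Nat.cast_nonneg N), mul_inv_cancel₀ hN',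
            ENNReal.ofReal_one, one_mul]
  have h3 : 1 ≤ E ^ 2 * r := by
    have := pow_le_pow_left' h1 2
    rwa [one_pow, mul_pow, ← ENNReal.rpow_natCast (r ^ _), ← ENNReal.rpow_mul,
      show (1 / 2 : ℝ) * (2 : ℕ) = 1 by norm_num, ENNReal.rpow_one] at this
  have hE2 : ENNReal.ofReal (Real.exp (-(divBound ρ k * M / (2 * N)))) * E ^ 2 = 1 := by
    rw [hE, ← ENNReal.ofReal_pow (Real.exp_pos _).le, ← ENNReal.ofReal_mul (Real.exp_pos _).le,
      ← Real.exp_nat_mul, ← Real.exp_add, ENNReal.ofReal_eq_one, Real.exp_eq_one_iff, hc]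
    push_cast
    field_simp
    ring
  calc _ = ENNReal.ofReal (Real.exp (-(divBound ρ k * M / (2 * N)))) * 1 := (mul_one _).symm
    _ ≤ ENNReal.ofReal (Real.exp (-(divBound ρ k * M / (2 * N)))) * (E ^ 2 * r) := by gcongr
    _ = r := by rw [← mul_assoc, hE2, one_mul]

end LowerBound

/-! ### Disjoint blocks inside each class. -/

section Classes

variable {n k : ℕ}

/-- The `j`-th block of `k` consecutive coordinates. -/
def block (n k j : ℕ) : Finset (Fin n) :=
  Finset.univ.filter fun i : Fin n => j * k ≤ i ∧ (i : ℕ) < (j + 1) * k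

lemma succ_mul_le_of_lt_div {j : ℕ} (hj : j < n / k) : (j + 1) * k ≤ n :=
  (Nat.mul_le_mul_right k hj).trans (Nat.div_mul_le_self n k)

lemma card_block {j : ℕ} (hj : j < n / k) : (block n k j).card = k := by
  have hjn := succ_mul_le_of_lt_div hj
  have : (block n k j).map Fin.valEmbedding = Finset.Ico (j * k) ((j + 1) * k) := by
    ext i
    simp only [block, Finset.mem_map, Finset.mem_filter, Finset.mem_univ, true_and,
      Fin.valEmbedding_apply, Finset.mem_Ico]
    constructor
    · rintro ⟨i, hi, rfl⟩
      exact hi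
    · exact fun hi => ⟨⟨i, by omega⟩, hi, rfl⟩
  rw [← Finset.card_map Fin.valEmbedding, this, Nat.card_Ico, add_mul, one_mul]
  omega

lemma disjoint_block {i j : ℕ} (hij : i ≠ j) : Disjoint (block n k i) (block n k j) := by
  rw [Finset.disjoint_left]
  intro x hi hj
  simp only [block, Finset.mem_filter, Finset.mem_univ, true_and] at hi hj
  have h1 : i < j + 1 := lt_of_mul_lt_mul_right (hi.1.trans_lt hj.2) (Nat.zero_le k)
  have h2 : j < i + 1 := lt_of_mul_lt_mul_right (hj.1.trans_lt hi.2) (Nat.zero_le k)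
  omega

/-- This lets a single argument serve all three classes. -/
lemma block_mem_sets (c : ClassKind) {j : ℕ} (hj : j < n / k) : block n k j ∈ c.sets n k := by
  cases c with
  | kSets => exact card_block hj
  | kIntervals =>
    refine ⟨j * k, ?_, ?_⟩
    · have := succ_mul_le_of_lt_div hj
      rwa [add_mul, one_mul] at this
    · simp only [block, add_mul, one_mul]
  | disjointKIntervals => exact ⟨j, hj, rfl⟩

end Classes

/-! ### Minimax bound and its asymptotic consequences. -/

section Minimax

lemma le_minimaxRisk (c : ClassKind) {n k M : ℕ} {ρ m : ℝ} (hk : 1 ≤ k) (hkn : k ≤ n)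
    (h0 : 0 < ρ) (h2 : ρ ≤ 1 / 2) (hm : (M : ℝ) = m * n) :
    ENNReal.ofReal (Real.exp (-(m * k * divBound ρ k)) / 4) ≤ minimaxRisk M ρ (c.sets n k) := by
  have hN : 0 < n / k := Nat.div_pos hkn hk
  have hD := divBound_nonneg h0.le (by linarith) k
  have hnk : (n : ℝ) ≤ 2 * (n / k : ℕ) * k := by
    -- As `⌊n/k⌋ ≥ 1`, rounding loses at most a factor `2`, which the `2` in `M / (2N)` absorbs.
    have h1 : n < k * (n / k + 1) := Nat.lt_mul_div_succ n hk
    have h3 : k * (n / k + 1) ≤ k * (2 * (n / k)) := Nat.mul_le_mul_left k (by omega)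
    have h4 : n ≤ 2 * (n / k) * k := by
      rw [mul_comm _ k]; omega
    exact_mod_cast h4
  have hn : (0 : ℝ) < n := by exact_mod_cast (by omega : 0 < n)
  have hm0 : 0 ≤ m := by
    by_contra! h
    have := mul_neg_of_neg_of_pos h hn
    have := Nat.cast_nonneg (α := ℝ) M
    linarith
  have hexp : divBound ρ k * M / (2 * (n / k : ℕ)) ≤ m * k * divBound ρ k := by
    rw [div_le_iff₀ (by positivity), hm]
    have := mul_le_mul_of_nonneg_left hnk (mul_nonneg hD hm0)
    linarith
  refine le_iInf fun A => le_iInf fun φ => le_iInf fun hφ => ?_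
  have h := exp_le_two_mul_risk (C := c.sets n k) (B := fun j : Fin (n / k) => block n k j) h0.le h2
    hN (fun j => block_mem_sets c j.2) (fun i j hij => disjoint_block (by simpa [Fin.ext_iff] using hij))
    (fun j => (card_block j.2).le) A hφ
  have h3 : 2 * ENNReal.ofReal (Real.exp (-(m * k * divBound ρ k)) / 4) ≤
      2 * risk ρ (c.sets n k) A φ := by
    refine le_trans ?_ h
    rw [← ENNReal.ofReal_ofNat, ← ENNReal.ofReal_mul (by norm_num)]
    -- Slack: the argument would give the constant `1/2` instead of `1/4`.
    refine ENNReal.ofReal_le_ofReal ?_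
    have := Real.exp_le_exp.2 (neg_le_neg hexp)
    have := Real.exp_pos (-(m * k * divBound ρ k))
    linarith
  exact (ENNReal.mul_le_mul_iff_right (by norm_num) (by norm_num)).1 h3

/-- If the minimax risk vanishes then `m k D` diverges, provided that `m k` diverges along the
parameters with `ρ > 1/2`. -/
lemma tendsto_of_minimaxRisk_tendsto_zero (c : ClassKind) {n k M : ℕ → ℕ} {ρ m : ℕ → ℝ}
    (hpar : ∀ j, 1 ≤ k j ∧ k j ≤ n j ∧ 0 < ρ j ∧ ρ j < 1 ∧ (M j : ℝ) = m j * n j)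
    (hmk : ∀ b : ℝ, ∀ᶠ j in atTop, 1 / 2 < ρ j → b ≤ m j * k j)
    (hR : Tendsto (fun j => minimaxRisk (M j) (ρ j) (c.sets (n j) (k j))) atTop (𝓝 0)) :
    Tendsto (fun j => m j * k j * divBound (ρ j) (k j)) atTop atTop := by
  rw [tendsto_atTop]
  intro b
  have hlt := hR.eventually_lt_const
    (u := ENNReal.ofReal (Real.exp (-b) / 4)) (by simpa using Real.exp_pos _)
  filter_upwards [hlt, hmk (2 * |b|)] with j hj hbj
  obtain ⟨hk, hkn, h0, h1, hM⟩ := hpar j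
  rcases le_or_gt (ρ j) (1 / 2) with h2 | h2
  · have h := (le_minimaxRisk c hk hkn h0 h2 hM).trans_lt hj
    have h' := (ENNReal.ofReal_lt_ofReal_iff_of_nonneg (by positivity)).1 h
    have h'' : Real.exp (-(m j * k j * divBound (ρ j) (k j))) < Real.exp (-b) := by linarith
    have := Real.exp_lt_exp.1 h''
    linarith
  · have hb := hbj h2
    -- For `ρ > 1/2` the first entry exceeds `1/2`, and so does `ρ² (k + 1) ≥ 2ρ²`. This is why `m k
    -- ≥ 2|b|` was requested.
    have hD : 1 / 2 ≤ divBound (ρ j) (k j) := by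
      have hk' : (1 : ℝ) ≤ k j := by exact_mod_cast hk
      refine le_min ?_ ?_
      · rw [le_div_iff₀ (by linarith)]
        linarith
      · nlinarith
    have := abs_nonneg b
    calc b ≤ |b| := le_abs_self b
      _ = 2 * |b| * (1 / 2) := by ring
      _ ≤ m j * k j * divBound (ρ j) (k j) :=
        mul_le_mul hb hD (by norm_num) (by linarith)

end Minimax

end CorrDetect

open CorrDetect in
theorem theorem1 (c : ClassKind) :
    (∀ (n k M : ℕ) (ρ m : ℝ), 1 ≤ k → k ≤ n → 0 < ρ → ρ ≤ 1 / 2 → (M : ℝ) = m * n →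
      ENNReal.ofReal (Real.exp (-(m * k * divBound ρ k)) / 4) ≤ minimaxRisk M ρ (c.sets n k)) ∧
    (∀ (n k M : ℕ → ℕ) (ρ m : ℕ → ℝ),
      (∀ j, 1 ≤ k j ∧ k j ≤ n j ∧ 0 < ρ j ∧ ρ j ≤ 1 / 2 ∧ (M j : ℝ) = m j * n j) →
      Tendsto (fun j => minimaxRisk (M j) (ρ j) (c.sets (n j) (k j))) atTop (𝓝 0) →
      Tendsto (fun j => m j * k j * divBound (ρ j) (k j)) atTop atTop) ∧
    (∀ (n k M : ℕ → ℕ) (ρ m : ℕ → ℝ),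
      (∀ j, 1 ≤ k j ∧ k j ≤ n j ∧ 0 < ρ j ∧ ρ j < 1 ∧ (M j : ℝ) = m j * n j) →
      Tendsto (fun j => m j * k j) atTop atTop →
      Tendsto (fun j => minimaxRisk (M j) (ρ j) (c.sets (n j) (k j))) atTop (𝓝 0) →
      Tendsto (fun j => m j * k j * divBound (ρ j) (k j)) atTop atTop) := by
  refine ⟨fun n k M ρ m hk hkn h0 h2 hm => le_minimaxRisk c hk hkn h0 h2 hm,
    fun n k M ρ m hpar hR => ?_, fun n k M ρ m hpar hmk hR => ?_⟩
  · refine tendsto_of_minimaxRisk_tendsto_zero c (fun j => ?_) (fun b => ?_) hR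
    · obtain ⟨hk, hkn, h0, h2, hm⟩ := hpar j
      exact ⟨hk, hkn, h0, by linarith, hm⟩
    · exact Eventually.of_forall fun j hj => absurd (hpar j).2.2.2.1 (not_le.2 hj)
  · refine tendsto_of_minimaxRisk_tendsto_zero c hpar (fun b => ?_) hR
    filter_upwards [hmk.eventually_ge_atTop b] with j hj _ using hj
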